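/- Let $F_0=0$, $F_1=1$, $F_{k}=F_{k-1}+F_{k-2}$ be the Fibonacci numbers. For a positive integer $N$, let $G_N$ be the simple graph with vertex set $\{1,2,\dots,N\}$ in which two distinct vertices $i\neq j$ are adjacent if and only if $i+j$ is a Fibonacci number, and let $\mathrm{Aut}(G_N)$ be its automorphism group. Let $n\geq 9$ be an integer divisible by $3$ (so that $F_{n-3}$, $F_n$ and $F_{n+3}$ are even), and let $N$ be an integer. (1) If $N\in\left[F_n,\tfrac32F_n\right)\cup\left[\tfrac12F_{n+3},\,F_{n+2}+\tfrac12F_{n-3}\right)\cup\left[F_{n+3}-\tfrac12F_n,\,F_{n+3}\right)$, then $\mathrm{Aut}(G_N)=\{\mathrm{id}\}$. (2) If $N\in\left[\tfrac32F_n,\,\tfrac12F_{n+3}\right)$, then $\mathrm{Aut}(G_N)=\{\mathrm{id},\phi\}$, where $\phi$ interchanges $\tfrac12F_n$ with $\tfrac32F_n$ and fixes all other vertices. (3) If $N\in\left[F_{n+2}+\tfrac12F_{n-3},\,F_{n+3}-\tfrac12F_n\right)$, then $\mathrm{Aut}(G_N)=\{\mathrm{id},\phi\}$, where $\phi$ interchanges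 $\tfrac12F_n$ with $\tfrac32F_n$, interchanges $F_{n+2}+\tfrac12F_{n-3}$ with $\tfrac12F_{n+3}$, and fixes all other vertices. Consequently, for every $N\geq 34$ the graph $G_N$ has at most one non-trivial automorphism. -/

import Mathlib

/-- The Fibonacci-sum graph `G_N`: its vertices are `1, …, N`, and distinct vertices `i`, `j` are
adjacent if and only if `i + j` is a Fibonacci number. -/
def fibSumGraph (N : ℕ) : SimpleGraph (Finset.Icc 1 N) where
  Adj i j := i ≠ j ∧ ∃ k : ℕ, Nat.fib k = (i : ℕ) + (j : ℕ)
  symm := ⟨fun _ _ h => ⟨h.1.symm, h.2.imp fun _ hk => hk.trans (Nat.add_comm _ _)⟩⟩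
  loopless := ⟨fun _ h => h.1 rfl⟩

/-- The automorphism group of `G_N`. -/
abbrev FibSumAut (N : ℕ) : Type := fibSumGraph N ≃g fibSumGraph N

/-- Fibonacci numbers whose index is divisible by `3` are even, so the halves `Nat.fib n / 2`,
`Nat.fib (n + 3) / 2` and `Nat.fib (n - 3) / 2` in the statement are exact. -/
theorem two_mul_fib_div_two {n : ℕ} (h : 3 ∣ n) : 2 * (Nat.fib n / 2) = Nat.fib n :=
  Nat.mul_div_cancel' (Nat.fib_dvd 3 n h)

/-!
A vertex `v` of `G_N` has degree `T (v + N) - level v`, where `T m` is the index of the largest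
Fibonacci number up to `m`. An automorphism preserves degrees, which leaves few candidates for the
images of the first vertices, and the edges between these show that `1` is fixed. Let `i > 1` be
the least moved vertex. Its smallest neighbour `a` is fixed, so the image of `i` is another
neighbour of `a`, and comparing degrees leaves three candidates. The edge sums of a 4-cycle in
`G_N` are very rigid, and pulling suitable paths back along the automorphism yields 4-cycles which
exclude two of the candidates; the third one requires `2i = F_n` and has `i` mapped to `3i`. The
edges and degrees near `3i` allow this only for `N` in two short ranges, which determine `n`.
Hence two non-trivial automorphisms `g`, `h` agree at `i`, and `h⁻¹ * g`, which fixes `i`, is the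
identity.
-/

/-! ### Sums of Fibonacci numbers -/

theorem three_dvd_of_even_fib {n : ℕ} (h : Even (Nat.fib n)) : 3 ∣ n := by
  have hgcd : Nat.fib (Nat.gcd 3 n) = 2 := by
    rw [Nat.fib_gcd]
    exact Nat.gcd_eq_left h.two_dvd
  rcases (Nat.dvd_prime Nat.prime_three).1 (Nat.gcd_dvd_left 3 n) with h1 | h3
  · simp [h1] at hgcd
  · exact Nat.gcd_eq_left_iff_dvd.1 h3

theorem greatestFib_eq_iff {k v : ℕ} :
    Nat.greatestFib v = k ↔ Nat.fib k ≤ v ∧ v < Nat.fib (k + 1) := by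
  rw [← Nat.le_greatestFib, ← Nat.greatestFib_lt]
  omega

theorem eq_greatestFib_add_two_of_fib_eq_two_mul {j v : ℕ} (hv : 2 ≤ v)
    (hj : Nat.fib j = 2 * v) : j = Nat.greatestFib v + 2 := by
  obtain ⟨k, hk⟩ : ∃ k, Nat.greatestFib v = k + 3 :=
    Nat.exists_eq_add_of_le' (Nat.le_greatestFib.2 hv)
  obtain ⟨hlo, hhi⟩ := greatestFib_eq_iff.1 hk
  have hpos : 0 < Nat.fib (k + 1) := Nat.fib_pos.2 k.succ_pos
  have h4 : k + 4 < j := Nat.fib_mono.reflect_lt (by simp only [Nat.fib_add_two] at *; omega)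
  have h6 : j < k + 6 := Nat.fib_mono.reflect_lt (by simp only [Nat.fib_add_two] at *; omega)
  omega

theorem fib_add_fib_eq_fib_add_fib_of_lt {r s t q : ℕ} (hr : 0 < Nat.fib r)
    (ht : Nat.fib t < Nat.fib s) (hq : Nat.fib q < Nat.fib s)
    (h : Nat.fib s + Nat.fib r = Nat.fib t + Nat.fib q) :
    ∃ j, s = j + 3 ∧ t = j + 2 ∧ q = j + 2 ∧ Nat.fib r = Nat.fib j := by
  have hts : t < s := Nat.fib_mono.reflect_lt ht
  have hqs : q < s := Nat.fib_mono.reflect_lt hq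
  have hs : 3 ≤ s := by
    by_contra! hs
    have := Nat.fib_mono (Nat.le_of_lt_succ hs)
    rw [Nat.fib_two] at this
    omega
  obtain ⟨j, rfl⟩ := Nat.exists_eq_add_of_le' hs
  have hrec : Nat.fib (j + 3) = Nat.fib (j + 1) + Nat.fib (j + 2) := Nat.fib_add_two
  have hrec' : Nat.fib (j + 2) = Nat.fib j + Nat.fib (j + 1) := Nat.fib_add_two
  have hmax {p : ℕ} (hp : p < j + 3) : Nat.fib p ≤ Nat.fib (j + 2) :=
    Nat.fib_mono (Nat.le_of_lt_succ hp)
  have heq {p p' : ℕ} (hp : p < j + 3) (hp' : p' < j + 3)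
      (hsum : Nat.fib (j + 3) < Nat.fib p + Nat.fib p') : p = j + 2 := by
    by_contra hne
    have := Nat.fib_mono (show p ≤ j + 1 by omega)
    have := hmax hp'
    omega
  obtain rfl := heq hts hqs (by omega)
  obtain rfl := heq hqs hts (by omega)
  exact ⟨j, rfl, rfl, rfl, by omega⟩

theorem eq_of_fib_eq_fib {s t : ℕ} (hs : 3 ≤ s) (h : Nat.fib s = Nat.fib t) : s = t := by
  have h2 : Nat.fib 2 < Nat.fib t := by
    rw [← h]
    exact (Nat.fib_lt_fib le_rfl).2 hs
  exact Nat.fib_strictMonoOn.injOn (show 2 ≤ s by omega) ((Nat.fib_lt_fib le_rfl).1 h2).le h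

/-- The two pairs of opposite sums of a 4-cycle have the same total, and since no two consecutive
sums agree, this total must be written as `F_{j+3} + F_j = F_{j+2} + F_{j+2}`. -/
theorem fib_fourCycle {w x y z l s t r : ℕ} (hy : 0 < y) (hz : 0 < z) (hwy : w ≠ y)
    (hxz : x ≠ z) (hwx : w + x = Nat.fib (l + 3)) (hxy : x + y = Nat.fib s)
    (hyz : y + z = Nat.fib t) (hzw : z + w = Nat.fib r) :
    s = l + 4 ∧ Nat.fib r = Nat.fib (l + 1) ∨ Nat.fib s = Nat.fib (l + 1) ∧ r = l + 4 ∨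
      s = l + 2 ∧ r = l + 2 ∨ s = l + 5 ∧ r = l + 5 := by
  have hsum : Nat.fib (l + 3) + Nat.fib t = Nat.fib s + Nat.fib r := by omega
  rcases lt_or_ge (Nat.fib s) (Nat.fib (l + 3)) with hs | hs <;>
    rcases lt_or_ge (Nat.fib r) (Nat.fib (l + 3)) with hr | hr
  · obtain ⟨j, h1, h2, h3, -⟩ := fib_add_fib_eq_fib_add_fib_of_lt (by omega) hs hr hsum
    omega
  · obtain ⟨j, h1, h2, h3, h4⟩ := fib_add_fib_eq_fib_add_fib_of_lt (s := r) (r := s) (t := l + 3)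
      (q := t) (by omega) (by omega) (by omega) (by omega)
    obtain rfl : j = l + 1 := by omega
    exact .inr (.inl ⟨h4, h1⟩)
  · obtain ⟨j, h1, h2, h3, h4⟩ := fib_add_fib_eq_fib_add_fib_of_lt (s := s) (r := r) (t := l + 3)
      (q := t) (by omega) (by omega) (by omega) (by omega)
    obtain rfl : j = l + 1 := by omega
    exact .inl ⟨h1, h4⟩
  · obtain ⟨j, h1, h2, h3, h4⟩ := fib_add_fib_eq_fib_add_fib_of_lt (s := t) (r := l + 3) (t := s)
      (q := r) (Nat.fib_pos.2 (by omega)) (by omega) (by omega) (by omega)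
    obtain rfl := eq_of_fib_eq_fib (by omega) h4
    omega

/-- Adjacency in `G_N`, as a relation on all natural numbers, so that vertices can be handled by
natural number arithmetic without carrying membership proofs. -/
structure SumAdj (N u v : ℕ) : Prop where
  one_le_left : 1 ≤ u
  left_le : u ≤ N
  one_le_right : 1 ≤ v
  right_le : v ≤ N
  ne : u ≠ v
  exists_fib : ∃ k, u + v = Nat.fib k

theorem SumAdj.symm {N u v : ℕ} (h : SumAdj N u v) : SumAdj N v u :=
  ⟨h.one_le_right, h.right_le, h.one_le_left, h.left_le, h.ne.symm,
    h.exists_fib.imp fun _ hk => (Nat.add_comm v u).trans hk⟩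

theorem SumAdj.add_eq_of_add_le {N u v : ℕ} (h : SumAdj N u v) (huv : u + v ≤ 20) :
    u + v = 3 ∨ u + v = 5 ∨ u + v = 8 ∨ u + v = 13 := by
  obtain ⟨hu, -, hv, -, hne, j, hj⟩ := h
  have hj8 : j < 8 := Nat.fib_mono.reflect_lt (hj ▸ huv.trans_lt (by decide))
  interval_cases j <;> norm_num at hj <;> omega

theorem SumAdj.fourCycle {N w x y z l r : ℕ} (hxy : SumAdj N x y) (hyz : SumAdj N y z)
    (hzw : z + w = Nat.fib r) (hwy : w ≠ y) (hxz : x ≠ z) (hwx : w + x = Nat.fib (l + 3)) :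
    x + y = Nat.fib (l + 4) ∧ z + w = Nat.fib (l + 1) ∨
      x + y = Nat.fib (l + 1) ∧ z + w = Nat.fib (l + 4) ∨
      x + y = Nat.fib (l + 2) ∧ z + w = Nat.fib (l + 2) ∨
      x + y = Nat.fib (l + 5) ∧ z + w = Nat.fib (l + 5) := by
  obtain ⟨s, hs⟩ := hxy.exists_fib
  obtain ⟨t, ht⟩ := hyz.exists_fib
  rw [hs, hzw]
  rcases fib_fourCycle hxy.one_le_right hyz.one_le_right hwy hxz hwx hs ht hzw with
    ⟨rfl, h⟩ | ⟨h, rfl⟩ | ⟨rfl, rfl⟩ | ⟨rfl, rfl⟩ <;> simp only [*, true_and, true_or, or_true]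

/-- The degree of the vertex `v` of `G_N`, counted among all natural numbers. -/
noncomputable def sumDeg (N v : ℕ) : ℕ := {x | SumAdj N v x}.ncard

/-- The amount by which the degree of `v` falls short of `Nat.greatestFib (v + N)`: besides the
Fibonacci numbers up to `v`, the sum `v + v` is lost when it is a Fibonacci number. -/
def level (v : ℕ) : ℕ :=
  Nat.greatestFib v + if Nat.fib (Nat.greatestFib (2 * v)) = 2 * v then 1 else 0

theorem greatestFib_le_level (v : ℕ) : Nat.greatestFib v ≤ level v :=
  Nat.le_add_right _ _

theorem fib_greatestFib_eq_self_iff {v : ℕ} :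
    Nat.fib (Nat.greatestFib v) = v ↔ ∃ j, Nat.fib j = v := by
  refine ⟨fun h => ⟨_, h⟩, ?_⟩
  rintro ⟨j, rfl⟩
  exact le_antisymm (Nat.fib_greatestFib_le _) (Nat.fib_mono (Nat.le_greatestFib.2 le_rfl))

theorem level_cases {v : ℕ} (hv : 2 ≤ v) :
    level v = Nat.greatestFib v ∧ Nat.fib (Nat.greatestFib v + 2) ≠ 2 * v ∨
      level v = Nat.greatestFib v + 1 ∧ Nat.fib (Nat.greatestFib v + 2) = 2 * v := by
  unfold level
  split_ifs with h
  · rw [eq_greatestFib_add_two_of_fib_eq_two_mul hv h] at h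
    exact .inr ⟨rfl, h⟩
  · exact .inl ⟨rfl, fun h' => h (fib_greatestFib_eq_self_iff.2 ⟨_, h'⟩)⟩

theorem sumDeg_add_level {N v : ℕ} (hv1 : 1 ≤ v) (hvN : v ≤ N) :
    sumDeg N v + level v = Nat.greatestFib (v + N) := by
  have hk2 : 2 ≤ Nat.greatestFib v := Nat.le_greatestFib.2 hv1
  have hkK : Nat.greatestFib v ≤ Nat.greatestFib (v + N) := Nat.greatestFib_mono (by omega)
  set S := (Finset.Ioc (Nat.greatestFib v) (Nat.greatestFib (v + N))).image Nat.fib with hS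
  have hmemS (x : ℕ) : x ∈ S ↔ v < x ∧ x ≤ v + N ∧ ∃ j, Nat.fib j = x := by
    simp only [hS, Finset.mem_image, Finset.mem_Ioc, Nat.le_greatestFib, Nat.greatestFib_lt]
    grind
  have hcardS : S.card = Nat.greatestFib (v + N) - Nat.greatestFib v := by
    rw [hS, Finset.card_image_of_injOn, Nat.card_Ioc]
    refine Nat.fib_strictMonoOn.injOn.mono fun j hj => ?_
    exact hk2.trans (Finset.mem_Ioc.1 hj).1.le
  have hneighbors : (v + ·) '' {x | SumAdj N v x} = (S.erase (2 * v) : Finset ℕ) := by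
    ext y
    simp only [Set.mem_image, Set.mem_ofPred_eq, Finset.mem_coe, Finset.mem_erase, hmemS]
    constructor
    · rintro ⟨x, ⟨-, -, hx1, hxN, hne, k, hk⟩, rfl⟩
      exact ⟨by omega, by omega, by omega, k, hk.symm⟩
    · rintro ⟨hne, hvy, hyN, k, hk⟩
      exact ⟨y - v, ⟨hv1, hvN, by omega, by omega, by omega, k, by omega⟩, by omega⟩
  have hdeg : sumDeg N v = (S.erase (2 * v)).card := by
    rw [sumDeg, ← Set.ncard_image_of_injective _ (add_right_injective v), hneighbors,
      Set.ncard_coe_finset]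
  have hhalf : 2 * v ∈ S ↔ Nat.fib (Nat.greatestFib (2 * v)) = 2 * v := by
    rw [hmemS, fib_greatestFib_eq_self_iff, and_iff_right (by omega), and_iff_right (by omega)]
  unfold level
  split_ifs with h
  · have := Finset.card_erase_add_one (hhalf.2 h)
    omega
  · rw [hdeg, Finset.erase_eq_of_notMem (mt hhalf.1 h)]
    omega

theorem greatestFib_add_le_add_two {N v : ℕ} (hv : v ≤ N) :
    Nat.greatestFib (v + N) ≤ Nat.greatestFib N + 2 := by
  refine Nat.le_of_lt_succ (Nat.greatestFib_lt.2 ?_)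
  have := Nat.lt_fib_greatestFib_add_one N
  have := Nat.fib_le_fib_succ (n := Nat.greatestFib N + 1)
  rw [Nat.fib_add_two]
  omega

theorem greatestFib_add_le_add_one {N v : ℕ} (hv : v < Nat.fib (Nat.greatestFib N)) :
    Nat.greatestFib (v + N) ≤ Nat.greatestFib N + 1 := by
  refine Nat.le_of_lt_succ (Nat.greatestFib_lt.2 ?_)
  have := Nat.lt_fib_greatestFib_add_one N
  rw [Nat.fib_add_two]
  omega

theorem add_fib_lt_of_greatestFib_add_two_le {N u v : ℕ}
    (h : Nat.greatestFib (u + N) + 2 ≤ Nat.greatestFib (v + N)) :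
    u + Nat.fib (Nat.greatestFib (u + N)) < v := by
  have := Nat.le_greatestFib.1 h
  have := Nat.lt_fib_greatestFib_add_one (u + N)
  rw [Nat.fib_add_two] at *
  omega

/-- A permutation of `ℕ` that extends an automorphism of `G_N` by the identity outside
`{1, …, N}`. -/
structure IsAut (N : ℕ) (g : Equiv.Perm ℕ) : Prop where
  adj_iff (u v : ℕ) : SumAdj N (g u) (g v) ↔ SumAdj N u v
  map_eq_self (u : ℕ) : u ∉ Finset.Icc 1 N → g u = u

namespace IsAut

variable {N : ℕ} {g h : Equiv.Perm ℕ}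

theorem map_mem_Icc_iff (hg : IsAut N g) {u : ℕ} : g u ∈ Finset.Icc 1 N ↔ u ∈ Finset.Icc 1 N := by
  refine ⟨fun hgu => ?_, fun hu => ?_⟩
  · by_contra hu
    exact hu (hg.map_eq_self u hu ▸ hgu)
  · by_contra hgu
    exact hgu ((g.injective (hg.map_eq_self _ hgu)).symm ▸ hu)

theorem sumDeg_map (hg : IsAut N g) (u : ℕ) : sumDeg N (g u) = sumDeg N u := by
  rw [sumDeg, sumDeg, ← Set.ncard_image_of_injective {v | SumAdj N u v} g.injective]
  congr 1
  ext v
  obtain ⟨x, rfl⟩ := g.surjective v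
  simp only [Set.mem_ofPred_eq, g.injective.mem_set_image, hg.adj_iff]

theorem greatestFib_map_add_level (hg : IsAut N g) {v : ℕ} (hv1 : 1 ≤ v) (hvN : v ≤ N) :
    Nat.greatestFib (g v + N) + level v = Nat.greatestFib (v + N) + level (g v) := by
  obtain ⟨hgv1, hgvN⟩ := Finset.mem_Icc.1 (hg.map_mem_Icc_iff.2 (Finset.mem_Icc.2 ⟨hv1, hvN⟩))
  rw [← sumDeg_add_level hv1 hvN, ← sumDeg_add_level hgv1 hgvN, hg.sumDeg_map]
  omega

theorem inv_mul (hg : IsAut N g) (hh : IsAut N h) : IsAut N (h⁻¹ * g) where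
  adj_iff u v := by
    rw [← hh.adj_iff, ← hg.adj_iff u v]
    simp only [Equiv.Perm.mul_apply, Equiv.Perm.coe_inv, Equiv.apply_symm_apply]
  map_eq_self u hu := by
    rw [Equiv.Perm.mul_apply, hg.map_eq_self u hu, Equiv.Perm.inv_eq_iff_eq, hh.map_eq_self u hu]

end IsAut

/-! ### The vertex `1` is fixed -/

theorem le_three_of_level_le_four {v : ℕ} (h : level v ≤ 4) : v ≤ 3 := by
  by_contra! hv
  have h4 : v ≠ 4 := by
    rintro rfl
    exact absurd h (by decide)
  have h5 : 5 ≤ Nat.greatestFib v := Nat.le_greatestFib.2 (show 5 ≤ v by omega)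
  have := greatestFib_le_level v
  omega

theorem le_seven_of_level_le_five {v : ℕ} (h : level v ≤ 5) : v ≤ 7 := by
  by_contra! hv
  have h6 : 6 ≤ Nat.greatestFib v := Nat.le_greatestFib.2 hv
  have := greatestFib_le_level v
  omega

theorem level_le_five {v : ℕ} (hv : v ≤ 7) : level v ≤ 5 := by
  interval_cases v <;> decide

namespace IsAut

variable {N : ℕ} {g : Equiv.Perm ℕ}

theorem level_map_add_le (hg : IsAut N g) (hN : 34 ≤ N) {v : ℕ} (hv1 : 1 ≤ v) (hv7 : v ≤ 7) :
    level (g v) + Nat.greatestFib (v + N) ≤ level v + Nat.greatestFib N + 1 := by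
  have hM : 9 ≤ Nat.greatestFib N := Nat.le_greatestFib.2 hN
  have hgv : g v ≤ N :=
    (Finset.mem_Icc.1 (hg.map_mem_Icc_iff.2 (Finset.mem_Icc.2 ⟨hv1, by omega⟩))).2
  have hdeg := hg.greatestFib_map_add_level hv1 (show v ≤ N by omega)
  have hlt : g v < Nat.fib (Nat.greatestFib N) := by
    by_contra! hge
    have := Nat.le_greatestFib.2 hge
    have := greatestFib_le_level (g v)
    have := greatestFib_add_le_add_two hgv
    have := level_le_five hv7
    have := Nat.greatestFib_mono (Nat.le_add_left N v)
    omega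
  have := greatestFib_add_le_add_one hlt
  omega

theorem map_one_ne_three (hg : IsAut N g) (hN : 34 ≤ N) : g 1 ≠ 3 := by
  intro h1
  have hdeg := hg.greatestFib_map_add_level le_rfl (show 1 ≤ N by omega)
  have hT := Nat.greatestFib_mono (Nat.le_add_left N 1)
  have hlevel1 : level 1 = 3 := by decide
  have hlevel3 : level 3 = 4 := by decide
  rw [h1, hlevel1, hlevel3] at hdeg
  have hmem {v : ℕ} (hv7 : g v ≤ 7) (hv : v = 2 ∨ v = 4 ∨ v = 7) : g v = 2 ∨ g v = 5 := by
    have hadj : SumAdj N 3 (g v) := by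
      rw [← h1, hg.adj_iff]
      exact ⟨le_rfl, by omega, by omega, by omega, by omega, by
        rcases hv with rfl | rfl | rfl
        exacts [⟨4, rfl⟩, ⟨5, rfl⟩, ⟨6, rfl⟩]⟩
    have := hadj.add_eq_of_add_le (by omega)
    have := hadj.one_le_right
    omega
  have hle {v : ℕ} (hv3 : 3 ≤ v) (hv7 : v ≤ 7) : g v ≤ 7 := by
    have := hg.level_map_add_le hN (show 1 ≤ v by omega) hv7
    have := level_le_five hv7
    have := Nat.greatestFib_mono (show 3 + N ≤ v + N by omega)
    exact le_seven_of_level_le_five (by omega)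
  have h2le : g 2 ≤ 7 := by
    have := hg.level_map_add_le hN one_le_two (by decide)
    have := Nat.greatestFib_mono (Nat.le_add_left N 2)
    have hlevel2 : level 2 = 3 := by decide
    exact le_seven_of_level_le_five (by omega)
  have h2 := hmem h2le (.inl rfl)
  have h4 := hmem (hle (by decide) (by decide)) (.inr (.inl rfl))
  have h7 := hmem (hle (by decide) le_rfl) (.inr (.inr rfl))
  have hne24 : g 2 ≠ g 4 := g.injective.ne (by decide)
  have hne27 : g 2 ≠ g 7 := g.injective.ne (by decide)
  have hne47 : g 4 ≠ g 7 := g.injective.ne (by decide)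
  omega

theorem map_two_ne_three (hg : IsAut N g) (hN : 34 ≤ N) (h1 : g 1 = 2) : g 2 ≠ 3 := by
  intro h2
  have hdeg := hg.greatestFib_map_add_level one_le_two (show 2 ≤ N by omega)
  have hT := Nat.greatestFib_mono (Nat.le_add_left N 2)
  have hlevel2 : level 2 = 3 := by decide
  have hlevel3 : level 3 = 4 := by decide
  rw [h2, hlevel2, hlevel3] at hdeg
  have h3 : g 3 ≤ 3 := by
    have := hg.level_map_add_le hN (v := 3) (by decide) (by decide)
    exact le_three_of_level_le_four (by omega)
  have hadj : SumAdj N (g 2) (g 3) :=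
    (hg.adj_iff 2 3).2 ⟨by decide, by omega, by decide, by omega, by decide, 5, rfl⟩
  rw [h2] at hadj
  have := hadj.add_eq_of_add_le (by omega)
  have := hadj.one_le_right
  have hne : g 3 ≠ g 1 := g.injective.ne (by decide)
  omega

theorem map_three_ne_four (hg : IsAut N g) (hN : 34 ≤ N) (h2 : g 2 = 1) : g 3 ≠ 4 := by
  intro h3
  have hdeg := hg.greatestFib_map_add_level (show 1 ≤ 3 by decide) (show 3 ≤ N by omega)
  have hT := Nat.greatestFib_mono (Nat.le_add_left N 3)
  have hT' := Nat.greatestFib_mono (show 4 + N ≤ 5 + N by omega)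
  have hlevel3 : level 3 = 4 := by decide
  have hlevel4 : level 4 = 5 := by decide
  have hlevel5 : level 5 = 5 := by decide
  rw [h3, hlevel3, hlevel4] at hdeg
  have h5 : g 5 ≤ 7 := by
    have := hg.level_map_add_le hN (v := 5) (by decide) (by decide)
    exact le_seven_of_level_le_five (by omega)
  have hadj : SumAdj N 4 (g 5) := by
    rw [← h3, hg.adj_iff]
    exact ⟨by decide, by omega, by decide, by omega, by decide, 6, rfl⟩
  have := hadj.add_eq_of_add_le (by omega)
  have := hadj.one_le_right
  have := hadj.ne
  have hne : g 5 ≠ g 2 := g.injective.ne (by decide)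
  omega

theorem map_three_ne_seven (hg : IsAut N g) (hN : 34 ≤ N) (h1 : g 1 = 2) (h2 : g 2 = 1) :
    g 3 ≠ 7 := by
  intro h3
  obtain ⟨x, hx⟩ := g.surjective 6
  have hx1 : SumAdj N x 1 := by
    rw [← hg.adj_iff, hx, h1]
    exact ⟨by decide, by omega, by decide, by omega, by decide, 6, rfl⟩
  have hx3 : SumAdj N 3 x := by
    rw [← hg.adj_iff, hx, h3]
    exact ⟨by decide, by omega, by decide, by omega, by decide, 7, rfl⟩
  have h23 : SumAdj N 2 3 := ⟨by decide, by omega, by decide, by omega, by decide, 5, rfl⟩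
  have hx2 : 2 ≠ x := by
    rintro rfl
    omega
  obtain ⟨r, hr⟩ := hx1.exists_fib
  have hcycle := h23.fourCycle hx3 hr (by decide) hx2 (l := 1) rfl
  have := hx1.one_le_left
  norm_num at hcycle
  omega

theorem map_one_ne_two (hg : IsAut N g) (hN : 34 ≤ N) : g 1 ≠ 2 := by
  intro h1
  have hdeg := hg.greatestFib_map_add_level le_rfl (show 1 ≤ N by omega)
  have hT := Nat.greatestFib_mono (Nat.le_add_left N 1)
  have hT3 := Nat.greatestFib_mono (Nat.le_add_left N 3)
  have hlevel1 : level 1 = 3 := by decide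
  have hlevel2 : level 2 = 3 := by decide
  have hlevel3 : level 3 = 4 := by decide
  rw [h1, hlevel1, hlevel2] at hdeg
  have hadj2 : SumAdj N (g 1) (g 2) :=
    (hg.adj_iff 1 2).2 ⟨by decide, by omega, by decide, by omega, by decide, 4, rfl⟩
  rw [h1] at hadj2
  have hadj3 : SumAdj N (g 2) (g 3) :=
    (hg.adj_iff 2 3).2 ⟨by decide, by omega, by decide, by omega, by decide, 5, rfl⟩
  have h2le : g 2 ≤ 3 := by
    have := hg.level_map_add_le hN one_le_two (by decide)
    exact le_three_of_level_le_four (by omega)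
  have h3le : g 3 ≤ 7 := by
    have := hg.level_map_add_le hN (v := 3) (by decide) (by decide)
    exact le_seven_of_level_le_five (by omega)
  have h2 : g 2 = 1 := by
    have := hg.map_two_ne_three hN h1
    have := hadj2.one_le_right
    have := hadj2.ne
    omega
  have := hg.map_three_ne_four hN h2
  have := hg.map_three_ne_seven hN h1 h2
  have := hadj3.add_eq_of_add_le (by omega)
  have := hadj3.ne
  have hne : g 3 ≠ g 1 := g.injective.ne (by decide)
  have := hadj3.one_le_right
  omega

theorem map_one (hg : IsAut N g) (hN : 34 ≤ N) : g 1 = 1 := by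
  have hle : g 1 ≤ 3 := by
    have := hg.level_map_add_le hN le_rfl (by decide)
    have := Nat.greatestFib_mono (Nat.le_add_left N 1)
    have hlevel1 : level 1 = 3 := by decide
    exact le_three_of_level_le_four (by omega)
  have h1 := (Finset.mem_Icc.1 (hg.map_mem_Icc_iff.2
    (Finset.mem_Icc.2 ⟨le_rfl, show 1 ≤ N by omega⟩))).1
  have := hg.map_one_ne_two hN
  have := hg.map_one_ne_three hN
  omega

end IsAut

/-! ### The least moved vertex -/

/-- `i` is the least vertex moved by the automorphism `g` of `G_N`, and `a` is its smallest
neighbour: since `F_{e+3} ≤ i < F_{e+4}`, this is `a = F_{e+4} - i`. -/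
structure FirstMoved (N : ℕ) (g : Equiv.Perm ℕ) (i a e : ℕ) : Prop where
  isAut : IsAut N g
  map_eq_self_of_lt (j : ℕ) : j < i → g j = j
  map_ne_self : g i ≠ i
  le : i ≤ N
  one_le : 1 ≤ a
  le_fib : a ≤ Nat.fib (e + 2)
  add_eq : i + a = Nat.fib (e + 4)

theorem IsAut.exists_firstMoved {N : ℕ} {g : Equiv.Perm ℕ} (hg : IsAut N g) (hN : 34 ≤ N)
    (hne : g ≠ 1) : ∃ i a e, FirstMoved N g i a e := by
  classical
  have hex : ∃ j, g j ≠ j := by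
    by_contra! hfix
    exact hne (Equiv.ext hfix)
  set i := Nat.find hex
  have hi : g i ≠ i := Nat.find_spec hex
  have hmem : 1 ≤ i ∧ i ≤ N := Finset.mem_Icc.1 (not_imp_comm.1 (hg.map_eq_self i) hi)
  have hi1 : i ≠ 1 := fun h => hi (h ▸ hg.map_one hN)
  obtain ⟨e, he⟩ : ∃ e, Nat.greatestFib i = e + 3 :=
    Nat.exists_eq_add_of_le' (Nat.le_greatestFib.2 (show 2 ≤ i by omega))
  obtain ⟨hlo, hhi : i < Nat.fib (e + 4)⟩ := greatestFib_eq_iff.1 he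
  have hrec : Nat.fib (e + 4) = Nat.fib (e + 2) + Nat.fib (e + 3) := Nat.fib_add_two
  have hleast (j : ℕ) (hj : j < i) : g j = j := not_not.1 (Nat.find_min hex hj)
  exact ⟨i, Nat.fib (e + 4) - i, e, hg, hleast, hi, hmem.2, by omega, by omega, by omega⟩

namespace FirstMoved

variable {N i a e d : ℕ} {g : Equiv.Perm ℕ}

theorem fib_le (h : FirstMoved N g i a e) : Nat.fib (e + 3) ≤ i := by
  have hrec : Nat.fib (e + 4) = Nat.fib (e + 2) + Nat.fib (e + 3) := Nat.fib_add_two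
  have := h.le_fib
  have := h.add_eq
  omega

theorem lt_fib (h : FirstMoved N g i a e) : a < Nat.fib (e + 3) :=
  h.le_fib.trans_lt (Nat.fib_lt_fib_succ (by omega))

theorem two_le (h : FirstMoved N g i a e) : 2 ≤ i :=
  le_trans (Nat.fib_mono (show 3 ≤ e + 3 by omega)) h.fib_le

theorem greatestFib_eq (h : FirstMoved N g i a e) : Nat.greatestFib i = e + 3 := by
  have := h.one_le
  have := h.add_eq
  exact greatestFib_eq_iff.2 ⟨h.fib_le, show i < Nat.fib (e + 4) by omega⟩

theorem map_neighbor (h : FirstMoved N g i a e) : g a = a :=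
  h.map_eq_self_of_lt a (h.lt_fib.trans_le h.fib_le)

theorem lt_map (h : FirstMoved N g i a e) : i < g i := by
  refine lt_of_le_of_ne ?_ h.map_ne_self.symm
  by_contra! hlt
  exact h.map_ne_self (g.injective (h.map_eq_self_of_lt _ hlt))

theorem map_adj (h : FirstMoved N g i a e) : SumAdj N (g i) a := by
  have hlt := h.lt_fib.trans_le h.fib_le
  have hadj : SumAdj N i a :=
    ⟨by have := h.two_le; omega, h.le, h.one_le, hlt.le.trans h.le, hlt.ne', e + 4, h.add_eq⟩
  rwa [← h.isAut.adj_iff, h.map_neighbor] at hadj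

theorem greatestFib_map (h : FirstMoved N g i a e) (hd : g i + a = Nat.fib (e + 5 + d)) :
    Nat.greatestFib (g i) = e + 4 + d := by
  have := h.one_le
  have ha : a ≤ Nat.fib (e + 3 + d) := h.lt_fib.le.trans (Nat.fib_mono (by omega))
  have hrec : Nat.fib (e + 3 + d + 2) = Nat.fib (e + 3 + d) + Nat.fib (e + 3 + d + 1) :=
    Nat.fib_add_two
  rw [greatestFib_eq_iff]
  grind

theorem le_greatestFib_add (h : FirstMoved N g i a e) (hd : g i + a = Nat.fib (e + 5 + d)) :
    e + 4 + d ≤ Nat.greatestFib (i + N) := by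
  rw [← h.greatestFib_map hd]
  exact Nat.greatestFib_mono (h.map_adj.left_le.trans (Nat.le_add_left N i))

theorem greatestFib_map_add_level (h : FirstMoved N g i a e) :
    Nat.greatestFib (g i + N) + level i = Nat.greatestFib (i + N) + level (g i) :=
  h.isAut.greatestFib_map_add_level (le_of_lt h.two_le) h.le

theorem level_self_cases (h : FirstMoved N g i a e) :
    level i = e + 3 ∧ Nat.fib (e + 5) ≠ 2 * i ∨ level i = e + 4 ∧ Nat.fib (e + 5) = 2 * i := by
  have := level_cases h.two_le
  rwa [h.greatestFib_eq] at this

theorem level_map_cases (h : FirstMoved N g i a e) (hd : g i + a = Nat.fib (e + 5 + d)) :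
    level (g i) = e + 4 + d ∧ Nat.fib (e + 6 + d) ≠ 2 * g i ∨
      level (g i) = e + 5 + d ∧ Nat.fib (e + 6 + d) = 2 * g i := by
  have := level_cases (h.two_le.trans h.lt_map.le)
  rw [h.greatestFib_map hd] at this
  grind

theorem exists_map_add_eq_fib (h : FirstMoved N g i a e) :
    ∃ d ≤ 2, g i + a = Nat.fib (e + 5 + d) := by
  obtain ⟨k, hk⟩ := h.map_adj.exists_fib
  have hlt : e + 4 < k := Nat.fib_mono.reflect_lt (by rw [← hk, ← h.add_eq]; grind [h.lt_map])
  obtain ⟨d, rfl⟩ := Nat.exists_eq_add_of_le hlt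
  refine ⟨d, ?_, hk⟩
  have hdeg := h.greatestFib_map_add_level
  have hT := greatestFib_add_le_add_two h.map_adj.left_le
  have hT' := Nat.greatestFib_mono (Nat.le_add_left N i)
  have := h.level_self_cases
  have := h.level_map_cases hk
  omega

theorem map_eq_fib_add (h : FirstMoved N g i a e) (hd : g i + a = Nat.fib (e + 5))
    (hle : Nat.fib (e + 4) + a ≤ N) : g i = Nat.fib (e + 4) + a := by
  -- Otherwise the preimage `x` of `F_{e+4} + a` is joined to `i` and to the fixed vertex
  -- `c = F_{e+3} - a`, which closes an impossible 4-cycle `a`, `i`, `x`, `c`.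
  by_contra hne
  obtain ⟨c, hc⟩ := Nat.exists_eq_add_of_le h.lt_fib.le
  obtain ⟨x, hx⟩ := g.surjective (Nat.fib (e + 4) + a)
  have hrec4 : Nat.fib (e + 4) = Nat.fib (e + 2) + Nat.fib (e + 3) := Nat.fib_add_two
  have hrec5 : Nat.fib (e + 5) = Nat.fib (e + 3) + Nat.fib (e + 4) := Nat.fib_add_two
  have hrec6 : Nat.fib (e + 6) = Nat.fib (e + 4) + Nat.fib (e + 5) := Nat.fib_add_two
  have ha := h.lt_fib
  have ha1 := h.one_le
  have hlo := h.fib_le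
  have hci : c < i := by omega
  have hgc : g c = c := h.map_eq_self_of_lt c hci
  have hix : SumAdj N i x := by
    rw [← h.isAut.adj_iff, hx]
    exact ⟨h.map_adj.one_le_left, h.map_adj.left_le, by omega, hle, hne, e + 6, by omega⟩
  have hxc : SumAdj N x c := by
    rw [← h.isAut.adj_iff, hx, hgc]
    exact ⟨by omega, hle, by omega, by omega, by omega, e + 5, by omega⟩
  have hax : a ≠ x := by
    rintro rfl
    rw [h.map_neighbor] at hx
    omega
  have hca : c + a = Nat.fib (e + 3) := by omega
  have hcycle := hix.fourCycle hxc hca hax hci.ne' (l := e + 1) (by rw [Nat.add_comm, h.add_eq])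
  have hpos : 0 < Nat.fib (e + 1) := Nat.fib_pos.2 e.succ_pos
  have := hix.one_le_right
  simp only [Nat.fib_add_two] at *
  omega

theorem map_ne_fib_add (h : FirstMoved N g i a e) (hd : g i + a = Nat.fib (e + 5)) :
    g i ≠ Nat.fib (e + 4) + a := by
  intro heq
  have hpos : 0 < Nat.fib (e + 1) := Nat.fib_pos.2 e.succ_pos
  have hadd := h.add_eq
  have hlt := h.lt_map
  have hhalf := h.level_map_cases (d := 0) hd
  have hhalf' := h.level_self_cases
  have hdeg := h.greatestFib_map_add_level
  have hfib := Nat.fib_mono (h.le_greatestFib_add (d := 0) hd)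
  have hjump : Nat.greatestFib (i + N) + 2 ≤ Nat.greatestFib (g i + N) := by
    simp only [Nat.fib_add_two, Nat.add_zero] at *
    omega
  have := add_fib_lt_of_greatestFib_add_two_le hjump
  simp only [Nat.fib_add_two] at *
  omega

theorem fib_add_le (h : FirstMoved N g i a e) (hd : g i + a = Nat.fib (e + 5)) :
    Nat.fib (e + 4) + a ≤ N := by
  by_contra! hN
  have hpos : 0 < Nat.fib (e + 1) := Nat.fib_pos.2 e.succ_pos
  have hadd := h.add_eq
  have hle := h.le_fib
  have hgiN := h.map_adj.left_le
  have hiT : Nat.greatestFib (i + N) = e + 5 := by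
    rw [greatestFib_eq_iff]
    simp only [Nat.fib_add_two] at *
    omega
  have hgiT : Nat.greatestFib (g i + N) = e + 5 := by
    rw [greatestFib_eq_iff]
    simp only [Nat.fib_add_two] at *
    omega
  have hdeg := h.greatestFib_map_add_level
  rw [hiT, hgiT] at hdeg
  have := h.level_map_cases (d := 0) hd
  have := h.level_self_cases
  simp only [Nat.fib_add_two] at *
  omega

theorem map_add_ne_fib_add_five (h : FirstMoved N g i a e) : g i + a ≠ Nat.fib (e + 5) :=
  fun hd => h.map_ne_fib_add hd (h.map_eq_fib_add hd (h.fib_add_le hd))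

/-- The preimages of `g i`, `u`, `v`, `a` form a 4-cycle through `i` and `a`, whose sum is the
known `F_{e+4}`, so `fib_fourCycle` leaves few possibilities for the sum of the preimage of `v`
and `a`. -/
theorem exists_adj_pullback (h : FirstMoved N g i a e) (hhalf : Nat.fib (e + 5) = 2 * i)
    {u v : ℕ} (hiu : SumAdj N (g i) u) (huv : SumAdj N u v) (hva : SumAdj N v a) (hvi : v ≠ g i)
    (hua : u ≠ a) : ∃ y, g y = v ∧ y + a = Nat.fib (e + 6) := by
  obtain ⟨x, rfl⟩ := g.surjective u
  obtain ⟨y, rfl⟩ := g.surjective v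
  have hix := (h.isAut.adj_iff _ _).1 hiu
  obtain ⟨r, hr⟩ := ((h.isAut.adj_iff y a).1 (by rwa [h.map_neighbor])).exists_fib
  have hax : a ≠ x := by
    rintro rfl
    exact hua h.map_neighbor
  have hiy : i ≠ y := fun hiy => hvi (congrArg g hiy.symm)
  have hcycle := hix.fourCycle ((h.isAut.adj_iff _ _).1 huv) hr hax hiy (l := e + 1)
    (by rw [Nat.add_comm, h.add_eq])
  have := h.fib_le
  have := hix.one_le_right
  have := hix.ne
  have := Nat.fib_le_fib_succ (n := e + 2)
  exact ⟨y, rfl, by grind⟩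

theorem fib_eqs (h : FirstMoved N g i a e) (hhalf : Nat.fib (e + 5) = 2 * i) :
    Nat.fib (e + 3) + a = i ∧ Nat.fib (e + 6) = 3 * i + a ∧ Nat.fib (e + 7) = 5 * i + a ∧
      Nat.fib (e + 8) = 8 * i + 2 * a ∧ Nat.fib (e + 9) = 13 * i + 3 * a ∧ 3 * a < i := by
  have hadd := h.add_eq
  have hpos : 0 < Nat.fib (e + 1) := Nat.fib_pos.2 e.succ_pos
  simp only [Nat.fib_add_two] at *
  omega

theorem fib_eq_two_mul_and_fib_le_of_map_add (h : FirstMoved N g i a e)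
    (hd : g i + a = Nat.fib (e + 7)) :
    Nat.fib (e + 5) = 2 * i ∧ Nat.fib (e + 8) ≤ g i + N := by
  have hdeg := h.greatestFib_map_add_level
  have hT := greatestFib_add_le_add_two h.map_adj.left_le
  have hT' := Nat.greatestFib_mono (Nat.le_add_left N i)
  have hT'' := h.le_greatestFib_add (d := 2) hd
  have hlevel := h.level_map_cases (d := 2) hd
  have hlevel' := h.level_self_cases
  rw [← Nat.le_greatestFib]
  omega

theorem exists_preimage_of_add_eq_fib_add_seven (h : FirstMoved N g i a e)
    (hd : g i + a = Nat.fib (e + 7)) :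
    ∃ z, g z + a = Nat.fib (e + 5) ∧ z + a = Nat.fib (e + 6) := by
  obtain ⟨hhalf, hN⟩ := h.fib_eq_two_mul_and_fib_le_of_map_add hd
  obtain ⟨h3, h6, h7, h8, -, hai⟩ := h.fib_eqs hhalf
  have ha := h.one_le
  have hadj1 : SumAdj N (g i) (3 * i + 2 * a) :=
    ⟨h.map_adj.one_le_left, h.map_adj.left_le, by omega, by omega, by omega, e + 8, by omega⟩
  have hadj2 : SumAdj N (3 * i + 2 * a) (2 * i - a) :=
    ⟨by omega, by omega, by omega, by omega, by omega, e + 7, by omega⟩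
  have hadj3 : SumAdj N (2 * i - a) a :=
    ⟨by omega, by omega, ha, by omega, by omega, e + 5, by omega⟩
  obtain ⟨z, hgz, hz⟩ := h.exists_adj_pullback hhalf hadj1 hadj2 hadj3 (by omega) (by omega)
  exact ⟨z, by omega, hz⟩

theorem map_add_ne_fib_add_seven (h : FirstMoved N g i a e) : g i + a ≠ Nat.fib (e + 7) := by
  intro hd
  obtain ⟨hhalf, hN⟩ := h.fib_eq_two_mul_and_fib_le_of_map_add hd
  obtain ⟨h3, h6, h7, h8, -, hai⟩ := h.fib_eqs hhalf
  have ha := h.one_le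
  obtain ⟨z, hgz, hz⟩ := h.exists_preimage_of_add_eq_fib_add_seven hd
  obtain ⟨w, hw⟩ := g.surjective (i + 2 * a)
  have hc : g (i - 2 * a) = i - 2 * a := h.map_eq_self_of_lt _ (by omega)
  have hzw : SumAdj N z w := by
    rw [← h.isAut.adj_iff, hw]
    exact ⟨by omega, by omega, by omega, by omega, by omega, e + 6, by omega⟩
  have hwc : SumAdj N w (i - 2 * a) := by
    rw [← h.isAut.adj_iff, hw, hc]
    exact ⟨by omega, by omega, by omega, by omega, by omega, e + 5, by omega⟩
  have haw : a ≠ w := by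
    rintro rfl
    have := h.map_neighbor
    omega
  have hzc : z ≠ i - 2 * a := by
    rintro rfl
    omega
  have hcycle := hzw.fourCycle hwc (r := e + 3) (by omega) haw hzc (l := e + 3)
    ((Nat.add_comm a z).trans hz)
  have := h.add_eq
  simp only [Nat.add_assoc, Nat.reduceAdd] at hcycle
  omega

theorem map_add_eq_fib_add_six (h : FirstMoved N g i a e) : g i + a = Nat.fib (e + 6) := by
  obtain ⟨d, hd2, hd⟩ := h.exists_map_add_eq_fib
  have := h.map_add_ne_fib_add_five
  have := h.map_add_ne_fib_add_seven
  interval_cases d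
  · contradiction
  · exact hd
  · contradiction

theorem greatestFib_map_add_le (h : FirstMoved N g i a e) :
    Nat.greatestFib (g i + N) ≤ Nat.greatestFib (i + N) + 1 := by
  have hd := h.map_add_eq_fib_add_six
  by_contra! hjump
  have hlt := add_fib_lt_of_greatestFib_add_two_le hjump
  have hfib := Nat.fib_mono (h.le_greatestFib_add (d := 1) hd)
  have hadd := h.add_eq
  simp only [Nat.fib_add_two] at *
  omega

theorem fib_eq_two_mul (h : FirstMoved N g i a e) : Nat.fib (e + 5) = 2 * i := by
  have := h.greatestFib_map_add_level
  have := h.greatestFib_map_add_le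
  have := h.level_map_cases (d := 1) h.map_add_eq_fib_add_six
  have := h.level_self_cases
  omega

theorem level_self (h : FirstMoved N g i a e) : level i = e + 4 := by
  have := h.fib_eq_two_mul
  have := h.level_self_cases
  omega

theorem level_map (h : FirstMoved N g i a e) : level (g i) = e + 5 := by
  have := h.greatestFib_map_add_level
  have := h.greatestFib_map_add_le
  have := h.level_map_cases (d := 1) h.map_add_eq_fib_add_six
  have := h.level_self
  omega

theorem greatestFib_map_add (h : FirstMoved N g i a e) :
    Nat.greatestFib (g i + N) = Nat.greatestFib (i + N) + 1 := by
  have := h.greatestFib_map_add_level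
  have := h.level_self
  have := h.level_map
  omega

theorem map_eq_three_mul (h : FirstMoved N g i a e) : g i = 3 * i := by
  have hd := h.map_add_eq_fib_add_six
  have := h.fib_eqs h.fib_eq_two_mul
  omega

theorem lt_fib_add_eight (h : FirstMoved N g i a e) : N < Nat.fib (e + 8) := by
  by_contra! hN
  have hhalf := h.fib_eq_two_mul
  have hlevel := h.level_map
  have hT := h.greatestFib_map_add
  obtain ⟨h3, h6, h7, h8, h9, hai⟩ := h.fib_eqs hhalf
  have ha := h.one_le
  have hgi := h.map_eq_three_mul
  have hadj1 : SumAdj N (g i) (5 * i + 2 * a) :=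
    ⟨by omega, by omega, by omega, by omega, by omega, e + 8, by omega⟩
  have hadj2 : SumAdj N (5 * i + 2 * a) (8 * i + a) :=
    ⟨by omega, by omega, by omega, by omega, by omega, e + 9, by omega⟩
  have hadj3 : SumAdj N (8 * i + a) a :=
    ⟨by omega, by omega, ha, by omega, by omega, e + 8, by omega⟩
  obtain ⟨y, hgy, hy⟩ := h.exists_adj_pullback hhalf hadj1 hadj2 hadj3 (by omega) (by omega)
  obtain rfl : y = g i := by omega
  have hdeg := h.isAut.greatestFib_map_add_level h.map_adj.one_le_left h.map_adj.left_le
  have hw : e + 7 ≤ Nat.greatestFib (g (g i)) := Nat.le_greatestFib.2 (by omega)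
  have hlevelw := greatestFib_le_level (g (g i))
  have hlt := add_fib_lt_of_greatestFib_add_two_le (N := N) (u := g i) (v := g (g i)) (by omega)
  have := Nat.fib_mono (Nat.le_greatestFib.2 (hN.trans (Nat.le_add_left N (g i))))
  omega

end FirstMoved

/-- The `N` for which `G_N` has a non-trivial automorphism, grouped by the index `n` with
`F_n / 2` the least moved vertex. -/
def swapRange (n : ℕ) : Set ℕ :=
  Set.Ico (3 * (Nat.fib n / 2)) (Nat.fib (n + 2) - Nat.fib n / 2) ∪
    Set.Ico (Nat.fib (n + 3) - 3 * (Nat.fib n / 2)) (Nat.fib (n + 3) - Nat.fib n / 2)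

theorem FirstMoved.mem_swapRange {N i a e : ℕ} {g : Equiv.Perm ℕ} (h : FirstMoved N g i a e) :
    N ∈ swapRange (e + 5) := by
  have hhalf := h.fib_eq_two_mul
  have hT := h.greatestFib_map_add
  obtain ⟨h3, h6, h7, h8, h9, hai⟩ := h.fib_eqs hhalf
  have hN8 := h.lt_fib_add_eight
  have hgiN := h.map_adj.left_le
  rw [h.map_eq_three_mul] at hT hgiN
  have hlo : e + 7 ≤ Nat.greatestFib (3 * i + N) := Nat.le_greatestFib.2 (by omega)
  have hhi : Nat.greatestFib (3 * i + N) < e + 9 := Nat.greatestFib_lt.2 (by omega)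
  simp only [swapRange, Set.mem_union, Set.mem_Ico, Nat.add_assoc, Nat.reduceAdd]
  rcases (show Nat.greatestFib (i + N) = e + 6 ∨ Nat.greatestFib (i + N) = e + 7 by omega) with
    hi | hi
  · have := (greatestFib_eq_iff.1 hi).2
    simp only [Nat.add_assoc, Nat.reduceAdd] at this
    omega
  · have := (greatestFib_eq_iff.1 hi).2
    have := (greatestFib_eq_iff.1 (hT.trans (congrArg Nat.succ hi))).1
    simp only [Nat.add_assoc, Nat.reduceAdd, Nat.succ_eq_add_one] at *
    omega

theorem IsAut.exists_mem_swapRange {N : ℕ} {g : Equiv.Perm ℕ} (hg : IsAut N g) (hN : 34 ≤ N)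
    (hne : g ≠ 1) :
    ∃ n, 3 ∣ n ∧ N ∈ swapRange n ∧ g (Nat.fib n / 2) = 3 * (Nat.fib n / 2) := by
  obtain ⟨i, a, e, h⟩ := hg.exists_firstMoved hN hne
  have hhalf := h.fib_eq_two_mul
  refine ⟨e + 5, three_dvd_of_even_fib (hhalf ▸ even_two_mul i), h.mem_swapRange, ?_⟩
  rw [hhalf, Nat.mul_div_cancel_left i two_pos, h.map_eq_three_mul]

theorem mem_Ico_of_mem_swapRange {n N : ℕ} (hn : 3 ∣ n) (h : N ∈ swapRange n) :
    N ∈ Set.Ico (Nat.fib n) (Nat.fib (n + 3)) := by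
  have := two_mul_fib_div_two hn
  have hle := Nat.fib_le_fib_succ (n := n)
  have hrec : Nat.fib (n + 3) = Nat.fib (n + 1) + Nat.fib (n + 2) := Nat.fib_add_two
  have hrec' : Nat.fib (n + 2) = Nat.fib n + Nat.fib (n + 1) := Nat.fib_add_two
  simp only [swapRange, Set.mem_union, Set.mem_Ico] at *
  omega

theorem eq_of_mem_swapRange {m n N : ℕ} (hm : 3 ∣ m) (hn : 3 ∣ n) (h : N ∈ swapRange m)
    (hN : N ∈ Set.Ico (Nat.fib n) (Nat.fib (n + 3))) : m = n := by
  have hN' := mem_Ico_of_mem_swapRange hm h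
  have := Nat.fib_mono.reflect_lt (hN.1.trans_lt hN'.2)
  have := Nat.fib_mono.reflect_lt (hN'.1.trans_lt hN.2)
  omega

theorem IsAut.eq_of_ne_one {N : ℕ} {g h : Equiv.Perm ℕ} (hg : IsAut N g) (hh : IsAut N h)
    (hN : 34 ≤ N) (hg1 : g ≠ 1) (hh1 : h ≠ 1) : g = h := by
  by_contra hne
  obtain ⟨n, hn, hNn, hgi⟩ := hg.exists_mem_swapRange hN hg1
  obtain ⟨m, hm, hNm, hhi⟩ := hh.exists_mem_swapRange hN hh1
  obtain ⟨k, hk, hNk, hki⟩ := (hg.inv_mul hh).exists_mem_swapRange hN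
    fun hone => hne (inv_mul_eq_one.1 hone).symm
  have hNIco := mem_Ico_of_mem_swapRange hn hNn
  obtain rfl := eq_of_mem_swapRange hm hn hNm hNIco
  obtain rfl := eq_of_mem_swapRange hk hn hNk hNIco
  rw [Equiv.Perm.mul_apply, Equiv.Perm.inv_eq_iff_eq, hgi, ← hhi, h.apply_eq_iff_eq] at hki
  have hfib : Nat.fib k = 0 := by
    have := two_mul_fib_div_two hn
    omega
  obtain rfl := Nat.fib_eq_zero.1 hfib
  have := hNIco.2
  norm_num at this
  omega

/-! ### The transpositions -/

theorem sumAdj_iff {N u v : ℕ} :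
    SumAdj N u v ↔ 1 ≤ u ∧ u ≤ N ∧ 1 ≤ v ∧ v ≤ N ∧ u ≠ v ∧ ∃ k, u + v = Nat.fib k :=
  ⟨fun ⟨hu, huN, hv, hvN, hne, hk⟩ => ⟨hu, huN, hv, hvN, hne, hk⟩,
    fun ⟨hu, huN, hv, hvN, hne, hk⟩ => ⟨hu, huN, hv, hvN, hne, hk⟩⟩

theorem swap_mul_swap_apply {α : Type*} [DecidableEq α] {i j p q : α} (hip : i ≠ p) (hiq : i ≠ q)
    (hjp : j ≠ p) (hjq : j ≠ q) (u : α) :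
    (Equiv.swap i j * Equiv.swap p q) u =
      if u = i then j else if u = j then i else if u = p then q else if u = q then p else u := by
  simp only [Equiv.Perm.mul_apply, Equiv.swap_apply_def]
  grind

section HalfFib

variable {n i N : ℕ}

theorem fib_eqs_of_half (hn : 4 ≤ n) (hi : Nat.fib n = 2 * i) :
    3 * i < Nat.fib (n + 1) ∧ Nat.fib (n + 1) < 4 * i ∧
      Nat.fib (n + 2) = Nat.fib (n + 1) + 2 * i ∧ Nat.fib (n + 3) = 2 * Nat.fib (n + 1) + 2 * i ∧
      Nat.fib (n + 5) = 5 * Nat.fib (n + 1) + 6 * i := by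
  obtain ⟨m, rfl⟩ := Nat.exists_eq_add_of_le' hn
  have hpos : 0 < Nat.fib (m + 1) := Nat.fib_pos.2 m.succ_pos
  simp only [Nat.add_assoc, Nat.reduceAdd, Nat.fib_add_two] at *
  omega

theorem exists_eq_fib_iff (hn : 4 ≤ n) (hi : Nat.fib n = 2 * i) {s : ℕ} (his : i < s)
    (hs : s < Nat.fib (n + 5)) :
    (∃ k, s = Nat.fib k) ↔
      s + 2 * i = Nat.fib (n + 1) ∨ s = 2 * i ∨ s = Nat.fib (n + 1) ∨
        s = Nat.fib (n + 1) + 2 * i ∨ s = 2 * Nat.fib (n + 1) + 2 * i ∨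
          s = 3 * Nat.fib (n + 1) + 4 * i := by
  obtain ⟨m, rfl⟩ := Nat.exists_eq_add_of_le' hn
  have hle := Nat.fib_le_fib_succ (n := m + 2)
  have h4 : Nat.fib (m + 4) = Nat.fib (m + 2) + Nat.fib (m + 3) := Nat.fib_add_two
  have h5 : Nat.fib (m + 5) = Nat.fib (m + 3) + Nat.fib (m + 4) := Nat.fib_add_two
  have h6 : Nat.fib (m + 6) = Nat.fib (m + 4) + Nat.fib (m + 5) := Nat.fib_add_two
  have h7 : Nat.fib (m + 7) = Nat.fib (m + 5) + Nat.fib (m + 6) := Nat.fib_add_two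
  have h8 : Nat.fib (m + 8) = Nat.fib (m + 6) + Nat.fib (m + 7) := Nat.fib_add_two
  simp only [Nat.add_assoc, Nat.reduceAdd] at *
  constructor
  · rintro ⟨k, rfl⟩
    have hmk : m + 2 < k := Nat.fib_mono.reflect_lt (by omega)
    have hkm : k < m + 9 := Nat.fib_mono.reflect_lt hs
    obtain ⟨d, rfl⟩ := Nat.exists_eq_add_of_lt hmk
    have hd : d < 6 := by omega
    interval_cases d <;> simp only [Nat.add_assoc, Nat.reduceAdd, true_or, or_true] <;> omega
  · rintro (h | h | h | h | h | h)
    exacts [⟨m + 3, by omega⟩, ⟨m + 4, by omega⟩, ⟨m + 5, by omega⟩, ⟨m + 6, by omega⟩,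
      ⟨m + 7, by omega⟩, ⟨m + 8, by omega⟩]

section Neighbors

variable (hn : 4 ≤ n) (hi : Nat.fib n = 2 * i) (hN : N + i < Nat.fib (n + 3)) {x : ℕ}
include hn hi hN

theorem sumAdj_half_iff (hiN : i ≤ N) : SumAdj N i x ↔ 1 ≤ x ∧ x ≤ N ∧
    (x + 3 * i = Nat.fib (n + 1) ∨ x + i = Nat.fib (n + 1) ∨ x = Nat.fib (n + 1) + i) := by
  obtain ⟨hlo, hhi, h2, h3, h5⟩ := fib_eqs_of_half hn hi
  rw [sumAdj_iff]
  by_cases hx : 1 ≤ x ∧ x ≤ N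
  · rw [exists_eq_fib_iff hn hi (by omega) (by omega)]
    omega
  · omega

theorem sumAdj_three_mul_half_iff (hiN : 3 * i ≤ N) : SumAdj N (3 * i) x ↔ 1 ≤ x ∧ x ≤ N ∧
    (x + 3 * i = Nat.fib (n + 1) ∨ x + i = Nat.fib (n + 1) ∨ x + i = 2 * Nat.fib (n + 1)) := by
  obtain ⟨hlo, hhi, h2, h3, h5⟩ := fib_eqs_of_half hn hi
  rw [sumAdj_iff]
  by_cases hx : 1 ≤ x ∧ x ≤ N
  · rw [exists_eq_fib_iff hn hi (by omega) (by omega)]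
    omega
  · omega

theorem sumAdj_iff_eq_half {q : ℕ} (hq : q = Nat.fib (n + 1) + i) (hqN : q ≤ N) :
    SumAdj N q x ↔ x = i := by
  obtain ⟨hlo, hhi, h2, h3, h5⟩ := fib_eqs_of_half hn hi
  rw [sumAdj_iff]
  by_cases hx : 1 ≤ x ∧ x ≤ N
  · rw [exists_eq_fib_iff hn hi (by omega) (by omega)]
    omega
  · omega

theorem sumAdj_iff_eq_three_mul_half {p : ℕ} (hp : p + i = 2 * Nat.fib (n + 1)) (hpN : p ≤ N) :
    SumAdj N p x ↔ x = 3 * i := by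
  obtain ⟨hlo, hhi, h2, h3, h5⟩ := fib_eqs_of_half hn hi
  rw [sumAdj_iff]
  by_cases hx : 1 ≤ x ∧ x ≤ N
  · rw [exists_eq_fib_iff hn hi (by omega) (by omega)]
    omega
  · omega

end Neighbors

theorem isAut_of_involutive {g : Equiv.Perm ℕ} (hg : Function.Involutive g)
    (hfix : ∀ u, u ∉ Finset.Icc 1 N → g u = u)
    (hadj : ∀ u v, SumAdj N u v → g u ≠ u → SumAdj N (g u) (g v)) : IsAut N g := by
  have hmap {u v : ℕ} (huv : SumAdj N u v) : SumAdj N (g u) (g v) := by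
    by_cases hu : g u = u
    · by_cases hv : g v = v
      · rwa [hu, hv]
      · exact (hadj v u huv.symm hv).symm
    · exact hadj u v huv hu
  refine ⟨fun u v => ⟨fun huv => ?_, hmap⟩, hfix⟩
  simpa only [hg u, hg v] using hmap huv

theorem isAut_swap (hn : 4 ≤ n) (hi : Nat.fib n = 2 * i) (hN : 3 * i ≤ N)
    (hNq : N < Nat.fib (n + 1) + i) : IsAut N (Equiv.swap i (3 * i)) := by
  obtain ⟨hlo, hhi, h2, h3, h5⟩ := fib_eqs_of_half hn hi
  have hN3 : N + i < Nat.fib (n + 3) := by omega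
  refine isAut_of_involutive (Equiv.swap_apply_self _ _) (fun u hu => ?_) fun u v huv hu => ?_
  · rw [Finset.mem_Icc] at hu
    exact Equiv.swap_apply_of_ne_of_ne (by omega) (by omega)
  · have hu' : u = i ∨ u = 3 * i := by
      by_contra! hne
      exact hu (Equiv.swap_apply_of_ne_of_ne hne.1 hne.2)
    rcases hu' with rfl | rfl
    · rw [sumAdj_half_iff hn hi hN3 (by omega)] at huv
      rw [Equiv.swap_apply_left, Equiv.swap_apply_of_ne_of_ne (by omega) (by omega),
        sumAdj_three_mul_half_iff hn hi hN3 hN]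
      omega
    · rw [sumAdj_three_mul_half_iff hn hi hN3 hN] at huv
      rw [Equiv.swap_apply_right, Equiv.swap_apply_of_ne_of_ne (by omega) (by omega),
        sumAdj_half_iff hn hi hN3 (by omega)]
      omega

theorem isAut_swap_mul_swap {p q : ℕ} (hn : 4 ≤ n) (hi : Nat.fib n = 2 * i)
    (hp : p + i = 2 * Nat.fib (n + 1)) (hq : q = Nat.fib (n + 1) + i) (hN : p ≤ N)
    (hN3 : N + i < Nat.fib (n + 3)) : IsAut N (Equiv.swap i (3 * i) * Equiv.swap p q) := by
  obtain ⟨hlo, hhi, h2, h3, h5⟩ := fib_eqs_of_half hn hi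
  have happly := swap_mul_swap_apply (i := i) (j := 3 * i) (p := p) (q := q) (by omega) (by omega)
    (by omega) (by omega)
  refine isAut_of_involutive (fun u => ?_) (fun u hu => ?_) fun u v huv hu => ?_
  · simp only [happly]
    grind
  · rw [Finset.mem_Icc] at hu
    rw [happly]
    grind
  · have hu' : u = i ∨ u = 3 * i ∨ u = p ∨ u = q := by
      rw [happly] at hu
      grind
    rw [happly, happly]
    rcases hu' with rfl | rfl | rfl | rfl
    · rw [sumAdj_half_iff hn hi hN3 (by omega)] at huv
      rw [if_pos rfl, sumAdj_three_mul_half_iff hn hi hN3 (by omega)]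
      split_ifs <;> omega
    · rw [sumAdj_three_mul_half_iff hn hi hN3 (by omega)] at huv
      rw [if_neg (by omega), if_pos rfl, sumAdj_half_iff hn hi hN3 (by omega)]
      split_ifs <;> omega
    · rw [sumAdj_iff_eq_three_mul_half hn hi hN3 hp hN] at huv
      rw [if_neg (by omega), if_neg (by omega), if_pos rfl,
        sumAdj_iff_eq_half hn hi hN3 hq (by omega), huv, if_neg (by omega), if_pos rfl]
    · rw [sumAdj_iff_eq_half hn hi hN3 hq (by omega)] at huv
      rw [if_neg (by omega), if_neg (by omega), if_neg (by omega), if_pos rfl,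
        sumAdj_iff_eq_three_mul_half hn hi hN3 hp hN, huv, if_pos rfl]

end HalfFib

/-! ### Automorphisms of the graph -/

namespace FibSumAut

variable {N : ℕ}

/-- The extension of an automorphism of `G_N` to a permutation of `ℕ` that is the identity outside
`{1, …, N}`. -/
def toPerm (φ : FibSumAut N) : Equiv.Perm ℕ :=
  Equiv.Perm.ofSubtype (p := fun x => x ∈ Finset.Icc 1 N) φ.toEquiv

theorem toPerm_coe (φ : FibSumAut N) (v : Finset.Icc 1 N) : φ.toPerm v = φ v :=
  Equiv.Perm.ofSubtype_apply_coe _ _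

theorem toPerm_injective : Function.Injective (toPerm (N := N)) := by
  intro φ ψ h
  ext v
  rw [← toPerm_coe, ← toPerm_coe, h]

theorem toPerm_one : (1 : FibSumAut N).toPerm = 1 :=
  map_one Equiv.Perm.ofSubtype

theorem toPerm_ne_one {φ : FibSumAut N} (hφ : φ ≠ 1) : φ.toPerm ≠ 1 := by
  rwa [← toPerm_one, toPerm_injective.ne_iff]

end FibSumAut

theorem sumAdj_coe {N : ℕ} (u v : Finset.Icc 1 N) :
    SumAdj N u v ↔ (fibSumGraph N).Adj u v := by
  obtain ⟨hu1, huN⟩ := Finset.mem_Icc.1 u.2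
  obtain ⟨hv1, hvN⟩ := Finset.mem_Icc.1 v.2
  simp only [sumAdj_iff, fibSumGraph, hu1, huN, hv1, hvN, true_and, ne_eq, Subtype.ext_iff,
    eq_comm (b := (u + v : ℕ))]

theorem FibSumAut.isAut_toPerm {N : ℕ} (φ : FibSumAut N) : IsAut N φ.toPerm where
  map_eq_self _ hu := Equiv.Perm.ofSubtype_apply_of_not_mem _ hu
  adj_iff u v := by
    by_cases huv : u ∈ Finset.Icc 1 N ∧ v ∈ Finset.Icc 1 N
    · lift u to Finset.Icc 1 N using huv.1
      lift v to Finset.Icc 1 N using huv.2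
      rw [toPerm_coe, toPerm_coe, sumAdj_coe, sumAdj_coe, φ.map_adj_iff]
    · have hmem (x : ℕ) : φ.toPerm x ∈ Finset.Icc 1 N ↔ x ∈ Finset.Icc 1 N :=
        Equiv.Perm.ofSubtype_apply_mem_iff_mem _ _
      have hout {x y : ℕ} (hxy : ¬(x ∈ Finset.Icc 1 N ∧ y ∈ Finset.Icc 1 N)) : ¬SumAdj N x y :=
        fun h => hxy ⟨Finset.mem_Icc.2 ⟨h.one_le_left, h.left_le⟩,
          Finset.mem_Icc.2 ⟨h.one_le_right, h.right_le⟩⟩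
      exact iff_of_false (hout (by rwa [hmem, hmem])) (hout huv)

theorem IsAut.exists_fibSumAut {N : ℕ} {g : Equiv.Perm ℕ} (hg : IsAut N g) :
    ∃ φ : FibSumAut N, ∀ v : Finset.Icc 1 N, (φ v : ℕ) = g v := by
  refine ⟨⟨g.subtypeEquiv fun _ => hg.map_mem_Icc_iff.symm, fun {u v} => ?_⟩, fun _ => rfl⟩
  rw [← sumAdj_coe, ← sumAdj_coe]
  exact hg.adj_iff u v

theorem FibSumAut.eq_of_ne_one {N : ℕ} (hN : 34 ≤ N) {φ ψ : FibSumAut N} (hφ : φ ≠ 1)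
    (hψ : ψ ≠ 1) : φ = ψ :=
  toPerm_injective
    (φ.isAut_toPerm.eq_of_ne_one ψ.isAut_toPerm hN (toPerm_ne_one hφ) (toPerm_ne_one hψ))

theorem IsAut.exists_univ_eq_pair {N u : ℕ} {g : Equiv.Perm ℕ} (hg : IsAut N g) (hN : 34 ≤ N)
    (hu : g u ≠ u) : ∃ φ : FibSumAut N, φ ≠ 1 ∧ (∀ v : Finset.Icc 1 N, (φ v : ℕ) = g v) ∧
      (Set.univ : Set (FibSumAut N)) = {1, φ} := by
  obtain ⟨φ, hφ⟩ := hg.exists_fibSumAut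
  have hφ1 : φ ≠ 1 := by
    rintro rfl
    exact hu (hφ ⟨u, not_imp_comm.1 (hg.map_eq_self u) hu⟩).symm
  refine ⟨φ, hφ1, hφ, (Set.eq_univ_of_forall fun ψ => ?_).symm⟩
  exact or_iff_not_imp_left.2 fun hψ => FibSumAut.eq_of_ne_one hN hψ hφ1

theorem FibSumAut.univ_eq_one {n N : ℕ} (hN : 34 ≤ N) (hn : 3 ∣ n)
    (hNn : N ∈ Set.Ico (Nat.fib n) (Nat.fib (n + 3))) (hr : N ∉ swapRange n) :
    (Set.univ : Set (FibSumAut N)) = {1} := by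
  refine (Set.eq_univ_of_forall fun φ => ?_).symm
  by_contra hφ
  obtain ⟨m, hm, hNm, -⟩ := φ.isAut_toPerm.exists_mem_swapRange hN (toPerm_ne_one hφ)
  exact hr (eq_of_mem_swapRange hm hn hNm hNn ▸ hNm)

theorem fib_half_eqs {n : ℕ} (hn : 3 ≤ n) (h3 : 3 ∣ n) :
    Nat.fib (n + 3) / 2 = Nat.fib (n + 1) + Nat.fib n / 2 ∧
      Nat.fib (n + 2) + Nat.fib (n - 3) / 2 + Nat.fib n / 2 = 2 * Nat.fib (n + 1) := by
  have hm := two_mul_fib_div_two (Nat.dvd_sub h3 dvd_rfl)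
  have hhalf := two_mul_fib_div_two h3
  obtain ⟨m, rfl⟩ := Nat.exists_eq_add_of_le' hn
  simp only [Nat.add_assoc, Nat.reduceAdd, Nat.add_sub_cancel, Nat.fib_add_two] at *
  omega

theorem Ico_fib_diff_swapRange {n : ℕ} (hn : 4 ≤ n) (h3 : 3 ∣ n) :
    Set.Ico (Nat.fib n) (Nat.fib (n + 3)) \ swapRange n =
      Set.Ico (Nat.fib n) (3 * (Nat.fib n / 2)) ∪
        Set.Ico (Nat.fib (n + 3) / 2) (Nat.fib (n + 2) + Nat.fib (n - 3) / 2) ∪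
        Set.Ico (Nat.fib (n + 3) - Nat.fib n / 2) (Nat.fib (n + 3)) := by
  obtain ⟨hq, hp⟩ := fib_half_eqs (by omega) h3
  have hi := two_mul_fib_div_two h3
  obtain ⟨hlo, hhi, h2, h3, -⟩ := fib_eqs_of_half hn hi.symm
  ext N
  simp only [swapRange, Set.mem_sdiff, Set.mem_union, Set.mem_Ico]
  omega

theorem mainTheorem1 :
    (∀ n : ℕ, 9 ≤ n → 3 ∣ n → ∀ N : ℕ,
      (N ∈ Set.Ico (Nat.fib n) (3 * (Nat.fib n / 2)) ∪
            Set.Ico (Nat.fib (n + 3) / 2) (Nat.fib (n + 2) + Nat.fib (n - 3) / 2) ∪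
            Set.Ico (Nat.fib (n + 3) - Nat.fib n / 2) (Nat.fib (n + 3)) →
        (Set.univ : Set (FibSumAut N)) = {1}) ∧
      (N ∈ Set.Ico (3 * (Nat.fib n / 2)) (Nat.fib (n + 3) / 2) →
        ∃ φ : FibSumAut N,
          φ ≠ 1 ∧
          (∀ v : Finset.Icc 1 N,
            (φ v : ℕ) = Equiv.swap (Nat.fib n / 2) (3 * (Nat.fib n / 2)) (v : ℕ)) ∧
          (Set.univ : Set (FibSumAut N)) = {1, φ}) ∧
      (N ∈ Set.Ico (Nat.fib (n + 2) + Nat.fib (n - 3) / 2) (Nat.fib (n + 3) - Nat.fib n / 2) →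
        ∃ φ : FibSumAut N,
          φ ≠ 1 ∧
          (∀ v : Finset.Icc 1 N,
            (φ v : ℕ) =
              Equiv.swap (Nat.fib n / 2) (3 * (Nat.fib n / 2))
                (Equiv.swap (Nat.fib (n + 2) + Nat.fib (n - 3) / 2) (Nat.fib (n + 3) / 2)
                  (v : ℕ))) ∧
          (Set.univ : Set (FibSumAut N)) = {1, φ})) ∧
    (∀ N : ℕ, 34 ≤ N → ∀ φ ψ : FibSumAut N, φ ≠ 1 → ψ ≠ 1 → φ = ψ) := by
  refine ⟨fun n hn h3 N => ?_, fun N hN φ ψ => FibSumAut.eq_of_ne_one hN⟩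
  have h34 : 34 ≤ Nat.fib n := Nat.fib_mono hn
  have hi := two_mul_fib_div_two h3
  have hn4 : 4 ≤ n := by omega
  obtain ⟨hlo, -, -, hfib3, -⟩ := fib_eqs_of_half hn4 hi.symm
  obtain ⟨hq, hp⟩ := fib_half_eqs (by omega) h3
  refine ⟨fun hN => ?_, fun hN => ?_, fun hN => ?_⟩
  · rw [← Ico_fib_diff_swapRange hn4 h3] at hN
    exact FibSumAut.univ_eq_one (h34.trans hN.1.1) h3 hN.1 hN.2
  · rw [Set.mem_Ico] at hN
    refine (isAut_swap hn4 hi.symm hN.1 (hq ▸ hN.2)).exists_univ_eq_pair (u := Nat.fib n / 2)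
      (by omega) ?_
    rw [Equiv.swap_apply_left]
    omega
  · rw [Set.mem_Ico] at hN
    refine (isAut_swap_mul_swap hn4 hi.symm hp hq hN.1 (by omega)).exists_univ_eq_pair
      (u := Nat.fib n / 2) (by omega) ?_
    rw [swap_mul_swap_apply (by omega) (by omega) (by omega) (by omega), if_pos rfl]
    omega
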